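/- Consider the delayed Boissonade–De Kepper (BD) model $$\dot x(t)=\eta\big(-(x(t)^3-\mu x(t)+\Lambda)-k\,x(t-\tau)\big),\qquad \eta>0,\ k>0,\ \tau\ge 0,\ \mu,\Lambda\in\mathbb R,\ \mu<k .$$ It has a unique equilibrium $x_e$, i.e. a unique real solution of $x_e^3+(k-\mu)x_e+\Lambda=0$. Put $a=3x_e^2-\mu$ and $b=k$, so that the characteristic equation of the linearization at $x_e$ is $\lambda+\eta a+\eta b e^{-\lambda\tau}=0$, and assume $a\ge 0$. (i) If $\eta b\tau<\pi/2$, then, whatever the values of $\mu<k$ and $\Lambda$ with $a\ge0$, the equilibrium $x_e$ of the nonlinear model is locally asymptotically stable: for every $\varepsilon>0$ there is $\delta>0$ such that for every continuous history $\varphi$ on $[-\tau,0]$ with $|\varphi-x_e|<\delta$ a solution exists for all $t\ge0$, and every such solution satisfies $|x(t)-x_e|<\varepsilon$ for all $t\ge 0$; moreover there is $\delta>0$ such that all solutions with such histories converge to $x_e$ as $t\to\infty$. Under the same assumptions every root of the characteristic equation has negative real part, and the loop transfer function $L(\lambda)=\eta b e^{-\lambda\tau}/(\lambda+\eta a)$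 satisfies the Nyquist condition $|L(i\omega)|<1$ at every frequency $\omega>0$ with $\arg L(i\omega)=\pi$. (ii) The exact stability condition for $0\le a<b$, multiplied by $b$, reads $\eta b\tau< b\,\dfrac{\arccos(-a/b)}{\sqrt{b^2-a^2}}$. For every fixed $b>0$, the minimum of its right-hand side over $0\le a<b$ is $\pi/2$ (attained at $a=0$). -/

import Mathlib

namespace BDModel

/-- `x` solves the scalar delay equation `x'(t) = f (x t) (x (t - τ))` for all forward time, with
the history `φ` prescribed on `[-τ, 0]`.  (Only the values of `x` on `[-τ, ∞)` matter.) -/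
structure IsDDESolution (f : ℝ → ℝ → ℝ) (τ : ℝ) (φ x : ℝ → ℝ) : Prop where
  continuousOn : ContinuousOn x (Set.Ici (-τ))
  history : ∀ s ∈ Set.Icc (-τ) 0, x s = φ s
  equation : ∀ t : ℝ, 0 < t → HasDerivAt x (f (x t) (x (t - τ))) t

/-- `e` is an equilibrium (constant solution) of `x'(t) = f (x t) (x (t - τ))`. -/
def IsEquilibrium (f : ℝ → ℝ → ℝ) (e : ℝ) : Prop :=
  f e e = 0

/-- The continuous histories on `[-τ, 0]` that stay within distance `δ` of `e`. -/
def IsHistoryNear (τ e δ : ℝ) (φ : ℝ → ℝ) : Prop :=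
  ContinuousOn φ (Set.Icc (-τ) 0) ∧ ∀ s ∈ Set.Icc (-τ) 0, |φ s - e| < δ

/-- Local asymptotic stability of `e` for `x'(t) = f (x t) (x (t - τ))`: Lyapunov stability
(including that histories close to `e` do have solutions for all forward time), and local
attractivity. -/
def LocallyAsymptoticallyStable (f : ℝ → ℝ → ℝ) (τ e : ℝ) : Prop :=
  (∀ ε : ℝ, 0 < ε → ∃ δ : ℝ, 0 < δ ∧ ∀ φ : ℝ → ℝ, IsHistoryNear τ e δ φ →
    (∃ x : ℝ → ℝ, IsDDESolution f τ φ x) ∧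
    ∀ x : ℝ → ℝ, IsDDESolution f τ φ x → ∀ t : ℝ, 0 ≤ t → |x t - e| < ε) ∧
  (∃ δ : ℝ, 0 < δ ∧ ∀ φ : ℝ → ℝ, IsHistoryNear τ e δ φ →
    ∀ x : ℝ → ℝ, IsDDESolution f τ φ x → Filter.Tendsto x Filter.atTop (nhds e))

/-- The right-hand side of the delayed Boissonade–De Kepper model
`x'(t) = η (-(x(t)^3 - μ x(t) + Λ) - k x(t - τ))`; here `y` stands for `x(t - τ)`. -/
def field (η μ Λ k : ℝ) (x y : ℝ) : ℝ :=
  η * (-(x ^ 3 - μ * x + Λ) - k * y)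

/-- The characteristic function `z + η a + η b e^{-z τ}` of the linearized model. -/
noncomputable def charFun (η a b τ : ℝ) (z : ℂ) : ℂ :=
  z + η * a + η * b * Complex.exp (-z * τ)

/-- The loop transfer function `η b e^{-z τ} / (z + η a)`. -/
noncomputable def loopTransfer (η a b τ : ℝ) (z : ℂ) : ℂ :=
  η * b * Complex.exp (-z * τ) / (z + η * a)

/-- The right-hand side of the exact stability condition
`η τ < arccos (-a / b) / √(b² - a²)`. -/
noncomputable def exactBound (a b : ℝ) : ℝ :=
  Real.arccos (-a / b) / Real.sqrt (b ^ 2 - a ^ 2)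

end BDModel

/-!
Write `y = x - e` for the deviation from an equilibrium.  The model becomes
`y'(t) = G (y t) - B y(t - τ)` with `B = η b` and a cubic `G` that satisfies `G 0 = 0`,
`G' 0 = -A` with `A = η a`, and `y * G y ≤ C * y ^ 2`.

*Characteristic roots.*  A root `z` of `z + A + B exp (-z τ)` with `0 ≤ Re z` would have
`|Im z| ≤ B`, so `|Im z| τ < π / 2`, so `cos (Im z τ) > 0`; since `A ≥ 0`, the real part of the
characteristic function is then positive (`re_neg_of_characteristic_root`).  The bound on the loop
gain at a phase crossing (`norm_loop_lt_one`) has the same reason.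

*Linear equation.*  The solution operator `T` over one delay (`delayOperator`) acts on
`C([0, τ], ℂ)`.  For `z ≠ 0` the resolvent equation `z φ - T φ = ψ` is a linear differential
equation with a two-point boundary condition, and it can be solved explicitly unless `z = exp (l τ)`
for a characteristic root `l` (`exists_root_of_mem_spectrum`).  Hence the spectral radius of `T` is
less than one, and by Gelfand's formula some power of `T` has norm at most `1 / 2`
(`exists_norm_delayOperator_pow_le`).

*Nonlinear equation.*  A solution is a sequence of segments of length `τ`.  The one-sided bound on
`G` yields an a priori bound from each segment to the next one (`IsDelayStep.abs_le`).  That bound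
gives global existence by the method of steps (`exists_isDDESolution`), and it shows that small
segments follow `T` up to a small relative error (`exists_norm_sub_delayOperator_le`).  A sequence
with this property decays geometrically, because `x ↦ ∑ k < N, ‖T ^ k x‖` is an equivalent norm
contracted by `T` (`exists_geometric_decay_of_approx_linear`).  This proves stability and
attractivity at once (`locallyAsymptoticallyStable_deviationField`).

*Exact bound.*  Both factors of `arccos (-a / b) * (b / √(b ^ 2 - a ^ 2))` are least at `a = 0`
(`isLeast_mul_exactBound`).
-/

namespace BDModel

open Set Filter Topology

/-! ### Perturbed linear iterations -/

/-- If some power of `T` has norm at most `1/2`, then every sequence that follows `T` up to a small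
relative error, as long as it stays small, decays geometrically once it starts small enough.
The reason is that `V x = ∑ k < N, ‖T ^ k x‖` is an equivalent norm contracted by `T`. -/
theorem exists_geometric_decay_of_approx_linear {E : Type*} [NormedAddCommGroup E]
    [NormedSpace ℂ E] (T : E →L[ℂ] E) {N : ℕ} (hN0 : N ≠ 0) (hN : ‖T ^ N‖ ≤ 1 / 2) :
    ∃ C q ε : ℝ, 0 < C ∧ 0 ≤ q ∧ q < 1 ∧ 0 < ε ∧ ∀ (ρ : ℝ) (y : ℕ → E),
      (∀ n, ‖y n‖ ≤ ρ → ‖y (n + 1) - T (y n)‖ ≤ ε * ‖y n‖) → C * ‖y 0‖ ≤ ρ →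
      ∀ n, ‖y n‖ ≤ C * ‖y 0‖ * q ^ n := by
  set V : E → ℝ := fun x => ∑ k ∈ Finset.range N, ‖(T ^ k) x‖ with hV
  set C : ℝ := 1 + ∑ k ∈ Finset.range N, ‖T ^ k‖ with hC
  have hC1 : 1 ≤ C := by
    have : 0 ≤ ∑ k ∈ Finset.range N, ‖T ^ k‖ := Finset.sum_nonneg fun _ _ => norm_nonneg _
    linarith
  have hlow : ∀ x, ‖x‖ ≤ V x := by
    intro x
    have := Finset.single_le_sum (f := fun k => ‖(T ^ k) x‖) (fun _ _ => norm_nonneg _)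
      (Finset.mem_range.2 (Nat.pos_of_ne_zero hN0))
    simpa only [pow_zero, one_apply_eq_self] using this
  have hup : ∀ x, V x ≤ C * ‖x‖ := by
    intro x
    have h1 : V x ≤ ∑ k ∈ Finset.range N, ‖T ^ k‖ * ‖x‖ :=
      Finset.sum_le_sum fun k _ => (T ^ k).le_opNorm x
    rw [← Finset.sum_mul] at h1
    nlinarith [norm_nonneg x]
  have hadd : ∀ x z, V (x + z) ≤ V x + V z := by
    intro x z
    simp only [hV, ← Finset.sum_add_distrib, map_add]
    exact Finset.sum_le_sum fun k _ => norm_add_le _ _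
  -- applying `T` shifts the sum by one term, so that only its two ends matter
  have hT : ∀ x, V (T x) ≤ V x - ‖x‖ / 2 := by
    intro x
    have h1 : V (T x) + ‖x‖ = V x + ‖(T ^ N) x‖ := by
      have h2 := Finset.sum_range_succ (fun k => ‖(T ^ k) x‖) N
      rw [Finset.sum_range_succ'] at h2
      simpa [hV, pow_succ] using h2
    have h3 := (T ^ N).le_opNorm x
    nlinarith [norm_nonneg x]
  have hC0 : 0 < C := by linarith
  refine ⟨C, 1 - 1 / (4 * C), 1 / (4 * C ^ 2), hC0, ?_, ?_, by positivity, ?_⟩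
  · have : 1 / (4 * C) ≤ 1 := by rw [div_le_one (by positivity)]; linarith
    linarith
  · have : 0 < 1 / (4 * C) := by positivity
    linarith
  intro ρ y hy h0
  have hkey : ∀ n, V (y n) ≤ C * ‖y 0‖ * (1 - 1 / (4 * C)) ^ n := by
    have hq0 : 0 ≤ 1 - 1 / (4 * C) := by
      have : 1 / (4 * C) ≤ 1 := by rw [div_le_one (by positivity)]; linarith
      linarith
    have hq1 : 1 - 1 / (4 * C) ≤ 1 := by
      have : 0 < 1 / (4 * C) := by positivity
      linarith
    intro n
    induction n with
    | zero => simpa using hup (y 0)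
    | succ n ih =>
      have hsmall : ‖y n‖ ≤ ρ := by
        refine (hlow _).trans (ih.trans (le_trans ?_ h0))
        exact mul_le_of_le_one_right (by positivity) (pow_le_one₀ hq0 hq1)
      have h1 : V (y (n + 1)) ≤ V (T (y n)) + V (y (n + 1) - T (y n)) := by
        simpa using hadd (T (y n)) (y (n + 1) - T (y n))
      have h2 : V (y (n + 1) - T (y n)) ≤ C * (1 / (4 * C ^ 2) * ‖y n‖) :=
        (hup _).trans (by gcongr; exact hy n hsmall)
      have h3 : C * (1 / (4 * C ^ 2) * ‖y n‖) = ‖y n‖ / (4 * C) := by field_simp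
      have h4 : ‖y n‖ / (4 * C) ≤ ‖y n‖ / 4 := by gcongr; linarith
      have h5 : V (y n) / C ≤ ‖y n‖ := by
        rw [div_le_iff₀ hC0]; linarith [hup (y n)]
      have h6 : V (y (n + 1)) ≤ V (y n) * (1 - 1 / (4 * C)) := by
        have h7 : V (y n) * (1 - 1 / (4 * C)) = V (y n) - V (y n) / C / 4 := by field_simp
        linarith [hT (y n)]
      calc V (y (n + 1)) ≤ V (y n) * (1 - 1 / (4 * C)) := h6
        _ ≤ C * ‖y 0‖ * (1 - 1 / (4 * C)) ^ n * (1 - 1 / (4 * C)) := by gcongr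
        _ = _ := by ring
  exact fun n => (hlow _).trans (hkey n)

/-! ### Scalar linear differential equations -/

/-- Grönwall's inequality on `[0, τ]` with a simple explicit bound. -/
theorem norm_le_exp_mul_of_norm_deriv_le {E : Type*} [NormedAddCommGroup E] [NormedSpace ℝ E]
    {w w' : ℝ → E} {τ K δ ε : ℝ} (hK : 0 ≤ K) (hε : 0 ≤ ε)
    (hw : ∀ s ∈ Icc 0 τ, HasDerivWithinAt w (w' s) (Icc 0 τ) s) (h0 : ‖w 0‖ ≤ δ)
    (hb : ∀ s ∈ Icc 0 τ, ‖w' s‖ ≤ K * ‖w s‖ + ε) {s : ℝ} (hs : s ∈ Icc 0 τ) :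
    ‖w s‖ ≤ Real.exp (K * τ) * (δ + ε * τ) := by
  have h1 := norm_le_gronwallBound_of_norm_deriv_right_le (fun s hs => (hw s hs).continuousWithinAt)
    (fun x hx => (hw x (Ico_subset_Icc_self hx)).mono_of_mem_nhdsWithin
      (Icc_mem_nhdsGE_of_mem hx)) h0
    (fun x hx => hb x (Ico_subset_Icc_self hx)) s hs
  have hδ : 0 ≤ δ := (norm_nonneg _).trans h0
  refine h1.trans ?_
  rw [sub_zero]
  have hmono : Real.exp (K * s) * (δ + ε * s) ≤ Real.exp (K * τ) * (δ + ε * τ) := by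
    have := hs.1
    have := hs.2
    gcongr
  refine le_trans ?_ hmono
  rcases hK.eq_or_lt with rfl | hK
  · simp [gronwallBound_K0]
  · rw [gronwallBound_of_K_ne_0 hK.ne']
    have h2 : Real.exp (K * s) - 1 ≤ K * s * Real.exp (K * s) := by
      have h3 := Real.add_one_le_exp (-(K * s))
      have h4 : Real.exp (K * s) * Real.exp (-(K * s)) = 1 := by
        rw [← Real.exp_add]; simp
      nlinarith [Real.exp_pos (K * s)]
    have h5 : ε / K * (Real.exp (K * s) - 1) ≤ ε / K * (K * s * Real.exp (K * s)) := by gcongr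
    have h6 : ε / K * (K * s * Real.exp (K * s)) = ε * s * Real.exp (K * s) := by
      field_simp
    linarith

/-- The solution of `w' = -c w + h`, `w 0 = w₀`, given by variation of constants. -/
noncomputable def linearSolution (c : ℂ) (h : ℝ → ℂ) (w₀ : ℂ) (s : ℝ) : ℂ :=
  Complex.exp (-c * s) * (w₀ + ∫ u in (0 : ℝ)..s, Complex.exp (c * u) * h u)

theorem linearSolution_zero (c : ℂ) (h : ℝ → ℂ) (w₀ : ℂ) : linearSolution c h w₀ 0 = w₀ := by
  simp [linearSolution]

theorem hasDerivAt_linearSolution (c : ℂ) {h : ℝ → ℂ} (hh : Continuous h) (w₀ : ℂ) (s : ℝ) :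
    HasDerivAt (linearSolution c h w₀) (-c * linearSolution c h w₀ s + h s) s := by
  have h1 : HasDerivAt (fun s : ℝ => ∫ u in (0 : ℝ)..s, Complex.exp (c * u) * h u)
      (Complex.exp (c * s) * h s) s :=
    (Continuous.integral_hasStrictDerivAt (by fun_prop) 0 s).hasDerivAt
  have h2 : HasDerivAt (fun s : ℝ => Complex.exp (-c * s)) (Complex.exp (-c * s) * -c) s := by
    have h3 : HasDerivAt (fun s : ℝ => -c * (s : ℂ)) (-c) s := by
      simpa using (Complex.ofRealCLM.hasDerivAt (x := s)).const_mul (-c)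
    exact h3.cexp
  refine (h2.mul (h1.const_add w₀)).congr_deriv ?_
  have h4 : Complex.exp (-c * s) * Complex.exp (c * s) = 1 := by
    rw [← Complex.exp_add]; simp
  simp only [linearSolution]
  linear_combination h s * h4

theorem continuous_linearSolution (c : ℂ) {h : ℝ → ℂ} (hh : Continuous h) (w₀ : ℂ) :
    Continuous (linearSolution c h w₀) :=
  continuous_iff_continuousAt.2 fun s => (hasDerivAt_linearSolution c hh w₀ s).continuousAt

/-- Solutions of `w' = -c w + h` on `[0, τ]` are determined by their initial value. -/
theorem eqOn_of_linear_ode {c : ℂ} {h w₁ w₂ : ℝ → ℂ} {τ : ℝ}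
    (h₁ : ∀ s ∈ Icc 0 τ, HasDerivWithinAt w₁ (-c * w₁ s + h s) (Icc 0 τ) s)
    (h₂ : ∀ s ∈ Icc 0 τ, HasDerivWithinAt w₂ (-c * w₂ s + h s) (Icc 0 τ) s)
    (h0 : w₁ 0 = w₂ 0) : EqOn w₁ w₂ (Icc 0 τ) := by
  intro s hs
  have := norm_le_exp_mul_of_norm_deriv_le (norm_nonneg c) le_rfl (δ := 0)
    (fun s hs => (h₁ s hs).sub (h₂ s hs)) (by simp [h0])
    (fun s hs => by
      have : -c * w₁ s + h s - (-c * w₂ s + h s) = -c * (w₁ s - w₂ s) := by ring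
      rw [this]; simp) hs
  simpa [sub_eq_zero] using this

/-! ### The solution operator of the linear delay equation -/

section delayOperator

variable (A B : ℂ) {τ : ℝ} (hτ : 0 ≤ τ)

/-- The solution on `[0, τ]` of `w' = -A w - B φ`, `w 0 = φ τ`. -/
noncomputable def delaySolution (φ : C(Icc 0 τ, ℂ)) : ℝ → ℂ :=
  linearSolution A (fun u => -B * IccExtend hτ φ u) (φ ⟨τ, hτ, le_rfl⟩)

theorem continuous_delayForcing (φ : C(Icc 0 τ, ℂ)) :
    Continuous fun u => -B * IccExtend hτ φ u :=
  continuous_const.mul φ.continuous.Icc_extend'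

theorem hasDerivAt_delaySolution (φ : C(Icc 0 τ, ℂ)) (s : ℝ) :
    HasDerivAt (delaySolution A B hτ φ) (-A * delaySolution A B hτ φ s + -B * IccExtend hτ φ s) s :=
  hasDerivAt_linearSolution A (continuous_delayForcing B hτ φ) _ s

theorem norm_IccExtend_le (φ : C(Icc 0 τ, ℂ)) (s : ℝ) : ‖IccExtend hτ φ s‖ ≤ ‖φ‖ :=
  φ.norm_coe_le_norm _

theorem norm_delaySolution_le (φ : C(Icc 0 τ, ℂ)) {s : ℝ} (hs : s ∈ Icc 0 τ) :
    ‖delaySolution A B hτ φ s‖ ≤ Real.exp (‖A‖ * τ) * (1 + ‖B‖ * τ) * ‖φ‖ := by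
  have h1 := norm_le_exp_mul_of_norm_deriv_le (norm_nonneg A)
    (mul_nonneg (norm_nonneg B) (norm_nonneg φ)) (δ := ‖φ‖)
    (fun s _ => (hasDerivAt_delaySolution A B hτ φ s).hasDerivWithinAt)
    (by rw [delaySolution, linearSolution_zero]; exact φ.norm_coe_le_norm _)
    (fun s _ => (norm_add_le _ _).trans (by
      rw [norm_mul, norm_mul, norm_neg, norm_neg]
      gcongr
      exact norm_IccExtend_le hτ φ s)) hs
  refine h1.trans (le_of_eq ?_)
  ring

/-- The solution operator over one delay of `y'(t) = -A y(t) - B y(t - τ)`: it sends the segment of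
a solution on one interval of length `τ` to the segment on the next one.  Both are read as functions
on `[0, τ]`. -/
noncomputable def delayOperator : C(Icc 0 τ, ℂ) →L[ℂ] C(Icc 0 τ, ℂ) :=
  LinearMap.mkContinuous
    { toFun := fun φ => ⟨fun s => delaySolution A B hτ φ s,
        (continuous_linearSolution A (continuous_delayForcing B hτ φ) _).comp
          continuous_subtype_val⟩
      map_add' := fun φ ψ => by
        ext s
        refine eqOn_of_linear_ode (h := fun u => -B * IccExtend hτ (φ + ψ) u)
          (fun s _ => (hasDerivAt_delaySolution A B hτ (φ + ψ) s).hasDerivWithinAt)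
          (fun s _ => (((hasDerivAt_delaySolution A B hτ φ s).add
            (hasDerivAt_delaySolution A B hτ ψ s)).congr_deriv ?_).hasDerivWithinAt) ?_ s.2
        · simp [IccExtend]; ring
        · simp [delaySolution, linearSolution_zero]
      map_smul' := fun r φ => by
        ext s
        refine eqOn_of_linear_ode (h := fun u => -B * IccExtend hτ (r • φ) u)
          (fun s _ => (hasDerivAt_delaySolution A B hτ (r • φ) s).hasDerivWithinAt)
          (fun s _ => (((hasDerivAt_delaySolution A B hτ φ s).const_mul r).congr_deriv
            ?_).hasDerivWithinAt) ?_ s.2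
        · simp [IccExtend]; ring
        · simp [delaySolution, linearSolution_zero] }
    (Real.exp (‖A‖ * τ) * (1 + ‖B‖ * τ))
    (fun φ => (ContinuousMap.norm_le _ (by positivity)).2 fun s =>
      norm_delaySolution_le A B hτ φ s.2)

theorem delayOperator_apply (φ : C(Icc 0 τ, ℂ)) (s : Icc 0 τ) :
    delayOperator A B hτ φ s = delaySolution A B hτ φ s := rfl

variable {A B}

/-- Every nonzero point of the spectrum of the solution operator has the form `exp (l τ)` with `l`
a root of the characteristic equation: the resolvent equation is a linear differential equation with
a two-point boundary condition, which can be solved by hand. -/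
theorem exists_root_of_mem_spectrum {z : ℂ} (hz0 : z ≠ 0)
    (hz : z ∈ spectrum ℂ (delayOperator A B hτ)) :
    ∃ l : ℂ, l + A + B * Complex.exp (-l * τ) = 0 ∧ Complex.exp (l * τ) = z := by
  set c : ℂ := A + B / z with hc
  suffices h : Complex.exp (-c * τ) = z by
    refine ⟨-c, ?_, h⟩
    have h1 : Complex.exp (- -c * τ) = z⁻¹ := by rw [← h, ← Complex.exp_neg]; ring_nf
    rw [h1, hc]
    ring
  by_contra hne
  apply hz
  change IsUnit (_ : C(Icc 0 τ, ℂ) →L[ℂ] C(Icc 0 τ, ℂ))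
  rw [ContinuousLinearMap.isUnit_iff_bijective]
  have happ : ∀ φ : C(Icc 0 τ, ℂ),
      (algebraMap ℂ (C(Icc 0 τ, ℂ) →L[ℂ] C(Icc 0 τ, ℂ)) z - delayOperator A B hτ) φ
        = z • φ - delayOperator A B hτ φ := by
    intro φ
    simp [Algebra.algebraMap_eq_smul_one]
  constructor
  · rw [injective_iff_map_eq_zero]
    intro φ hφ
    rw [happ, sub_eq_zero] at hφ
    have hval : ∀ s : Icc 0 τ, z * φ s = delaySolution A B hτ φ s := fun s => by
      simpa [delayOperator_apply] using congrArg (fun f : C(Icc 0 τ, ℂ) => f s) hφ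
    have hval' : ∀ s ∈ Icc 0 τ, z * IccExtend hτ φ s = delaySolution A B hτ φ s := fun s hs => by
      rw [IccExtend_of_mem hτ _ hs]; exact hval ⟨s, hs⟩
    set x₀ := φ ⟨τ, hτ, le_rfl⟩ with hx₀
    have hsol : EqOn (delaySolution A B hτ φ) (fun s => Complex.exp (-c * s) * x₀) (Icc 0 τ) := by
      refine eqOn_of_linear_ode (c := c) (h := fun _ => 0) (fun s hs => ?_) (fun s hs => ?_) ?_
      · refine ((hasDerivAt_delaySolution A B hτ φ s).congr_deriv ?_).hasDerivWithinAt
        rw [← hval' s hs, hc]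
        field_simp
        ring
      · have h := hasDerivAt_linearSolution c (h := fun _ => 0) continuous_const x₀ s
        have heq : linearSolution c (fun _ => 0) x₀ = fun s : ℝ => Complex.exp (-c * s) * x₀ := by
          ext; simp [linearSolution]
        rw [heq] at h
        exact h.hasDerivWithinAt
      · simp [delaySolution, linearSolution_zero, hx₀]
    have hx : x₀ = 0 := by
      have h1 := hval ⟨τ, hτ, le_rfl⟩
      rw [hsol ⟨hτ, le_rfl⟩, ← hx₀] at h1
      have h2 : (z - Complex.exp (-c * τ)) * x₀ = 0 := by linear_combination h1
      exact (mul_eq_zero.1 h2).resolve_left (sub_ne_zero.2 (Ne.symm hne))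
    ext s
    have h1 := hval s
    rw [hsol s.2, hx] at h1
    simp only [mul_zero] at h1
    exact (mul_eq_zero.1 h1).resolve_left hz0
  · intro ψ
    -- `χ` is to be `T φ`, where `z φ = ψ + T φ`; the constant makes the boundary condition hold
    set h : ℝ → ℂ := fun u => -(B / z) * IccExtend hτ ψ u with hh
    have hcont : Continuous h := continuous_const.mul ψ.continuous.Icc_extend'
    set p : ℂ := linearSolution c h 0 τ with hp
    set x₀ : ℂ := (ψ ⟨τ, hτ, le_rfl⟩ + p) / (z - Complex.exp (-c * τ)) with hx₀
    have hd : z - Complex.exp (-c * τ) ≠ 0 := sub_ne_zero.2 (Ne.symm hne)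
    set χ : ℝ → ℂ := linearSolution c h x₀ with hχ
    have hχτ : χ τ = Complex.exp (-c * τ) * x₀ + p := by
      simp only [hχ, hp, linearSolution]; ring
    let χ' : C(Icc 0 τ, ℂ) := ⟨fun s => χ s,
      (continuous_linearSolution c hcont x₀).comp continuous_subtype_val⟩
    have hχ' : ∀ s, χ' s = χ s := fun _ => rfl
    refine ⟨z⁻¹ • (ψ + χ'), ?_⟩
    rw [happ, sub_eq_iff_eq_add, smul_smul, mul_inv_cancel₀ hz0, one_smul]
    congr 1
    ext s
    rw [delayOperator_apply, hχ']
    refine eqOn_of_linear_ode (c := A) (h := fun u => -B * IccExtend hτ (z⁻¹ • (ψ + χ')) u)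
      (fun s hs => ?_) (fun s _ => (hasDerivAt_delaySolution A B hτ _ s).hasDerivWithinAt) ?_ s.2
    · have hder : HasDerivAt χ (-c * χ s + h s) s := hasDerivAt_linearSolution c hcont x₀ s
      refine (hder.congr_deriv ?_).hasDerivWithinAt
      simp only [hh, IccExtend_of_mem hτ _ hs, hc, ContinuousMap.smul_apply,
        ContinuousMap.add_apply, hχ', smul_eq_mul]
      field_simp
      ring
    · have h0 : χ 0 = x₀ := linearSolution_zero c h x₀
      rw [h0, delaySolution, linearSolution_zero]
      simp [hχ', hχτ]
      have : (z - Complex.exp (-c * τ)) * x₀ = ψ ⟨τ, hτ, le_rfl⟩ + p := by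
        rw [hx₀, mul_div_cancel₀ _ hd]
      rw [eq_inv_mul_iff_mul_eq₀ hz0]
      linear_combination (norm := (simp; try ring)) this

/-- If all roots of the characteristic equation lie in the open left half plane, then some power of
the solution operator is a contraction, by Gelfand's formula. -/
theorem exists_norm_delayOperator_pow_le (hτ' : 0 < τ)
    (hroots : ∀ l : ℂ, l + A + B * Complex.exp (-l * τ) = 0 → l.re < 0) :
    ∃ N : ℕ, N ≠ 0 ∧ ‖delayOperator A B hτ'.le ^ N‖ ≤ 1 / 2 := by
  have : Nonempty (Icc 0 τ) := ⟨⟨0, le_rfl, hτ'.le⟩⟩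
  set T := delayOperator A B hτ'.le with hT
  have hlt : spectralRadius ℂ T < (1 : NNReal) := by
    refine spectrum.spectralRadius_lt_of_forall_lt T fun z hz => ?_
    rcases eq_or_ne z 0 with rfl | hz0
    · simp
    obtain ⟨l, hl, rfl⟩ := exists_root_of_mem_spectrum hτ'.le hz0 hz
    rw [← NNReal.coe_lt_coe, coe_nnnorm, Complex.norm_exp]
    simpa using mul_neg_of_neg_of_pos (hroots l hl) hτ'
  obtain ⟨r, hr, hr1⟩ := ENNReal.lt_iff_exists_nnreal_btwn.1 hlt
  have hr1' : r < 1 := by exact_mod_cast hr1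
  have h1 := (spectrum.pow_nnnorm_pow_one_div_tendsto_nhds_spectralRadius T).eventually_lt_const hr
  have h2 : ∀ᶠ n : ℕ in atTop, (r : ℝ) ^ n < 1 / 2 :=
    (tendsto_pow_atTop_nhds_zero_of_lt_one r.2 (by exact_mod_cast hr1')).eventually_lt_const
      (by norm_num)
  obtain ⟨N, ⟨hN1, hN2⟩, hN0⟩ := ((h1.and h2).and (eventually_ne_atTop 0)).exists
  refine ⟨N, hN0, le_trans ?_ hN2.le⟩
  have h3 : ((‖T ^ N‖₊ : ENNReal)) < r ^ N := by
    have h4 := ENNReal.rpow_lt_rpow hN1 (z := N) (by positivity)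
    rw [← ENNReal.rpow_mul, one_div_mul_cancel (by exact_mod_cast hN0), ENNReal.rpow_one,
      ENNReal.rpow_natCast] at h4
    exact h4
  have h5 : ‖T ^ N‖₊ < r ^ N := by exact_mod_cast h3
  exact_mod_cast h5.le

end delayOperator

/-! ### One delay interval of the nonlinear equation -/

/-- `v` continues the segment `u` of a solution of `y'(t) = G (y t) - B y(t - τ)` over one more
delay.  Both segments are read as functions on `[0, τ]`. -/
structure IsDelayStep (G : ℝ → ℝ) (B τ : ℝ) (u v : ℝ → ℝ) : Prop where
  start : v 0 = u τ
  deriv : ∀ s ∈ Icc 0 τ, HasDerivWithinAt v (G (v s) - B * u s) (Icc 0 τ) s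

theorem IsDelayStep.continuousOn {G : ℝ → ℝ} {B τ : ℝ} {u v : ℝ → ℝ}
    (h : IsDelayStep G B τ u v) : ContinuousOn v (Icc 0 τ) :=
  fun s hs => (h.deriv s hs).continuousWithinAt

/-- The growth factor over one delay interval in the a priori bound. -/
noncomputable def growthFactor (B C τ : ℝ) : ℝ :=
  Real.sqrt (Real.exp ((2 * C + |B|) * τ) * (1 + |B| * τ))

/-- A priori bound: `x * G x ≤ C * x ^ 2` makes `v ^ 2` grow at most exponentially. -/
theorem IsDelayStep.abs_le {G : ℝ → ℝ} {B C τ m : ℝ} {u v : ℝ → ℝ}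
    (hC0 : 0 ≤ C) (hG : ∀ x, x * G x ≤ C * x ^ 2) (h : IsDelayStep G B τ u v)
    (hu : ∀ s ∈ Icc 0 τ, |u s| ≤ m) {s : ℝ} (hs : s ∈ Icc 0 τ) :
    |v s| ≤ growthFactor B C τ * m := by
  have hτ : 0 ≤ τ := hs.1.trans hs.2
  have hm : 0 ≤ m := (abs_nonneg _).trans (hu 0 ⟨le_rfl, hτ⟩)
  set κ : ℝ := 2 * C + |B| with hκ
  have hκ0 : 0 ≤ κ := by positivity
  set g : ℝ → ℝ := fun s => Real.exp (-κ * s) * v s ^ 2 - |B| * m ^ 2 * s with hg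
  have hder : ∀ s ∈ Icc 0 τ, HasDerivWithinAt g
      (Real.exp (-κ * s) * (2 * v s * (G (v s) - B * u s) - κ * v s ^ 2) - |B| * m ^ 2)
      (Icc 0 τ) s := by
    intro s hs
    have h1 : HasDerivAt (fun s : ℝ => Real.exp (-κ * s)) (Real.exp (-κ * s) * -κ) s := by
      have h2 : HasDerivAt (fun s : ℝ => -κ * s) (-κ) s := by
        simpa using (hasDerivAt_id s).const_mul (-κ)
      exact h2.exp
    have h3 : HasDerivAt (fun s : ℝ => |B| * m ^ 2 * s) (|B| * m ^ 2) s := by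
      simpa using (hasDerivAt_id s).const_mul (|B| * m ^ 2)
    refine ((h1.hasDerivWithinAt.mul ((h.deriv s hs).pow 2)).sub
      h3.hasDerivWithinAt).congr_deriv ?_
    simp
    ring
  have hanti : AntitoneOn g (Icc 0 τ) := by
    refine antitoneOn_of_hasDerivWithinAt_nonpos (convex_Icc 0 τ)
      (fun s hs => (hder s hs).continuousWithinAt)
      (fun s hs => (hder s (interior_subset hs)).mono interior_subset) fun s hs => ?_
    have hs := interior_subset hs
    have h1 : -(2 * B * u s * v s) ≤ |B| * (m ^ 2 + v s ^ 2) := by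
      have h2 : -(2 * B * u s * v s) ≤ |B| * (2 * |u s| * |v s|) := by
        have := neg_le_abs (2 * B * u s * v s)
        rw [abs_mul, abs_mul, abs_mul, abs_two] at this
        linarith
      have h3 : 2 * |u s| * |v s| ≤ m ^ 2 + v s ^ 2 := by
        have := hu s hs
        have := sq_abs (v s)
        nlinarith [sq_nonneg (m - |v s|), abs_nonneg (v s)]
      exact h2.trans (by gcongr)
    have h2 : 2 * v s * (G (v s) - B * u s) - κ * v s ^ 2 ≤ |B| * m ^ 2 := by
      have := hG (v s)
      rw [hκ]
      nlinarith
    have h3 : Real.exp (-κ * s) ≤ 1 := Real.exp_le_one_iff.2 (by nlinarith [hs.1])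
    have h4 : 0 ≤ |B| * m ^ 2 := by positivity
    nlinarith [Real.exp_pos (-κ * s)]
  have h0 := hanti ⟨le_rfl, hτ⟩ hs hs.1
  have hv0 : v 0 ^ 2 ≤ m ^ 2 := by
    rw [h.start, sq_le_sq, abs_of_nonneg hm]
    exact hu τ ⟨hτ, le_rfl⟩
  simp only [hg, mul_zero, Real.exp_zero, one_mul, sub_zero] at h0
  have h1 : Real.exp (-κ * s) * v s ^ 2 ≤ m ^ 2 * (1 + |B| * τ) := by
    have : |B| * m ^ 2 * s ≤ |B| * m ^ 2 * τ := by gcongr; exact hs.2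
    linarith
  have h2 : v s ^ 2 ≤ Real.exp (κ * τ) * (1 + |B| * τ) * m ^ 2 := by
    have h3 : Real.exp (κ * s) * Real.exp (-κ * s) = 1 := by rw [← Real.exp_add]; simp
    calc v s ^ 2 = Real.exp (κ * s) * (Real.exp (-κ * s) * v s ^ 2) := by
          rw [← mul_assoc, h3, one_mul]
      _ ≤ Real.exp (κ * τ) * (m ^ 2 * (1 + |B| * τ)) := by gcongr; exact hs.2
      _ = _ := by ring
  rw [growthFactor, ← abs_of_nonneg hm, ← Real.sqrt_sq_eq_abs m, ← Real.sqrt_mul (by positivity)]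
  exact Real.abs_le_sqrt h2

/-- A segment of a real solution as an element of the complex state space. -/
noncomputable def complexSegment {τ : ℝ} (u : ℝ → ℝ) (hu : ContinuousOn u (Icc 0 τ)) :
    C(Icc 0 τ, ℂ) :=
  ⟨fun s => (u s : ℂ),
    Complex.continuous_ofReal.comp (continuousOn_iff_continuous_domRestrict.1 hu)⟩

theorem abs_le_norm_complexSegment {τ : ℝ} {u : ℝ → ℝ} (hu : ContinuousOn u (Icc 0 τ)) {s : ℝ}
    (hs : s ∈ Icc 0 τ) : |u s| ≤ ‖complexSegment u hu‖ := by
  have := (complexSegment u hu).norm_coe_le_norm ⟨s, hs⟩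
  simpa [complexSegment] using this

theorem norm_complexSegment_le {τ m : ℝ} {u : ℝ → ℝ} (hu : ContinuousOn u (Icc 0 τ)) (hm : 0 ≤ m)
    (h : ∀ s ∈ Icc 0 τ, |u s| ≤ m) : ‖complexSegment u hu‖ ≤ m :=
  (ContinuousMap.norm_le _ hm).2 fun s => by simpa [complexSegment] using h s s.2

/-- Small segments evolve, up to a small relative error, by the linearized equation. -/
theorem exists_norm_sub_delayOperator_le {G : ℝ → ℝ} {A B C τ : ℝ} (hτ : 0 ≤ τ) (hC0 : 0 ≤ C)
    (hG : ∀ x, x * G x ≤ C * x ^ 2) (hG0 : G 0 = 0) (hA : HasDerivAt G (-A) 0) {ε : ℝ}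
    (hε : 0 < ε) :
    ∃ ρ > 0, ∀ (u v : ℝ → ℝ) (hu : ContinuousOn u (Icc 0 τ)) (h : IsDelayStep G B τ u v),
      ‖complexSegment u hu‖ ≤ ρ →
      ‖complexSegment v h.continuousOn - delayOperator (A : ℂ) (B : ℂ) hτ (complexSegment u hu)‖
        ≤ ε * ‖complexSegment u hu‖ := by
  set K := growthFactor B C τ with hK
  have hK0 : 0 ≤ K := Real.sqrt_nonneg _
  set M : ℝ := Real.exp (|A| * τ) * τ * K with hM
  have hM0 : 0 ≤ M := by positivity
  set ε' : ℝ := ε / (M + 1) with hε'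
  have hε'0 : 0 < ε' := by positivity
  have h1 := (hasDerivAt_iff_isLittleO_nhds_zero.1 hA).def hε'0
  obtain ⟨r, hr, hball⟩ := Metric.eventually_nhds_iff.1 h1
  refine ⟨r / (2 * (K + 1)), by positivity, fun u v hu h hsmall => ?_⟩
  set m := ‖complexSegment u hu‖ with hm
  have hm0 : 0 ≤ m := norm_nonneg _
  set φ := complexSegment u hu with hφ
  have hv : ∀ s ∈ Icc 0 τ, |v s| ≤ K * m := fun s hs =>
    h.abs_le hC0 hG (fun s hs => abs_le_norm_complexSegment hu hs) hs
  have hKm : K * m < r := by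
    have h2 : K * m ≤ K * (r / (2 * (K + 1))) := by gcongr
    have h3 : K * (r / (2 * (K + 1))) ≤ r / 2 := by
      have : K * (r / (2 * (K + 1))) = r / 2 * (K / (K + 1)) := by field_simp
      rw [this]
      exact mul_le_of_le_one_right (by positivity) ((div_le_one (by positivity)).2 (by linarith))
    linarith
  have hrem : ∀ s ∈ Icc 0 τ, |G (v s) + A * v s| ≤ ε' * (K * m) := by
    intro s hs
    have h2 : ‖G (v s) + A * v s‖ ≤ ε' * ‖v s‖ := by
      have := hball (y := v s) (by simpa using (hv s hs).trans_lt hKm)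
      simpa [hG0, mul_comm] using this
    rw [Real.norm_eq_abs, Real.norm_eq_abs] at h2
    exact h2.trans (by gcongr; exact hv s hs)
  refine (ContinuousMap.norm_le _ (by positivity)).2 fun s => ?_
  -- the error `w` solves `w' = -A w + (G v + A v)` with `w 0 = 0`
  have hw := norm_le_exp_mul_of_norm_deriv_le (K := |A|) (δ := 0) (ε := ε' * (K * m)) (τ := τ)
    (w := fun s => (v s : ℂ) - delaySolution A B hτ φ s) (abs_nonneg A) (by positivity)
    (fun s hs => ((h.deriv s hs).ofReal_comp).sub
      (hasDerivAt_delaySolution (A : ℂ) B hτ φ s).hasDerivWithinAt)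
    (by simp [delaySolution, linearSolution_zero, h.start, hφ, complexSegment])
    (fun s hs => by
      have h2 : ((G (v s) - B * u s : ℝ) : ℂ) -
          (-(A : ℂ) * delaySolution A B hτ φ s + -(B : ℂ) * IccExtend hτ φ s)
          = -(A : ℂ) * ((v s : ℂ) - delaySolution A B hτ φ s) + ((G (v s) + A * v s : ℝ) : ℂ) := by
        rw [IccExtend_of_mem hτ _ hs]
        simp only [hφ, complexSegment, ContinuousMap.coe_mk]
        push_cast
        ring
      rw [h2]
      refine (norm_add_le _ _).trans (add_le_add (by simp) ?_)
      rw [Complex.norm_real]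
      exact hrem s hs) s.2
  refine le_trans hw ?_
  have h3 : Real.exp (|A| * τ) * (0 + ε' * (K * m) * τ) = ε * (M / (M + 1)) * m := by
    rw [hε', hM]; field_simp; ring
  rw [h3]
  gcongr
  exact mul_le_of_le_one_right hε.le ((div_le_one (by positivity)).2 (by linarith))

/-- Every continuous segment can be continued.  The nonlinearity is truncated outside the range
allowed by the a priori bound, so that the Picard–Lindelöf theorem covers the whole interval. -/
theorem exists_isDelayStep {G : ℝ → ℝ} {B C τ : ℝ} (hτ : 0 ≤ τ) (hC0 : 0 ≤ C)
    (hGd : ContDiff ℝ 1 G) (hG : ∀ x, x * G x ≤ C * x ^ 2) {u : ℝ → ℝ}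
    (hu : ContinuousOn u (Icc 0 τ)) : ∃ v, IsDelayStep G B τ u v := by
  obtain ⟨m, hm⟩ := isCompact_Icc.exists_bound_of_continuousOn hu
  replace hm : ∀ s ∈ Icc 0 τ, |u s| ≤ m := hm
  have hm0 : 0 ≤ m := (abs_nonneg _).trans (hm 0 ⟨le_rfl, hτ⟩)
  set R : ℝ := growthFactor B C τ * m + 1 with hR
  have hR0 : 0 < R := by
    have : 0 ≤ growthFactor B C τ := Real.sqrt_nonneg _
    positivity
  have hRR : -R ≤ R := by linarith
  set P : ℝ → ℝ := fun x => projIcc (-R) R hRR x with hP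
  have hPmem : ∀ x, P x ∈ Icc (-R) R := fun x => (projIcc (-R) R hRR x).2
  have hPeq : ∀ x, |x| ≤ R → P x = x := fun x hx => by
    simp [hP, projIcc_of_mem hRR (abs_le.1 hx)]
  -- truncation keeps the one-sided bound on the nonlinearity
  have hGP : ∀ x, x * G (P x) ≤ C * x ^ 2 := by
    intro x
    rcases le_or_gt |x| R with hx | hx
    · rw [hPeq x hx]; exact hG x
    · rcases lt_abs.1 hx with hx | hx
      · have h1 : P x = R := by simp [hP, projIcc_of_right_le hRR hx.le]
        have h2 := hG R
        have h3 : G R ≤ C * R := by nlinarith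
        have h4 : C * R ≤ C * x := by gcongr
        rw [h1]
        nlinarith
      · have h1 : P x = -R := by
          simp [hP, projIcc_of_le_left hRR (by linarith : x ≤ -R)]
        have h2 := hG (-R)
        have h3 : -G (-R) ≤ C * R := by nlinarith
        have h4 : C * R ≤ C * -x := by gcongr
        rw [h1]
        nlinarith
  obtain ⟨L, hL⟩ : ∃ L, LipschitzOnWith L G (Icc (-R) R) :=
    (hGd.locallyLipschitz.locallyLipschitzOn).exists_lipschitzOnWith_of_compact isCompact_Icc
  have hLP : LipschitzWith L (fun x => G (P x)) := by
    refine LipschitzWith.of_dist_le_mul fun x y => ?_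
    have h1 : dist (P x) (P y) ≤ dist x y :=
      ((LipschitzWith.projIcc hRR).dist_le_mul x y).trans_eq (one_mul _)
    exact (hL.dist_le_mul _ (hPmem x) _ (hPmem y)).trans (by gcongr)
  obtain ⟨M₁, hM₁⟩ := isCompact_Icc.exists_bound_of_continuousOn
    (hGd.continuous.continuousOn (s := Icc (-R) R))
  set M : ℝ := M₁ + |B| * m with hM
  have hM0 : 0 ≤ M := by
    have : 0 ≤ M₁ := (norm_nonneg _).trans (hM₁ 0 ⟨by linarith, hR0.le⟩)
    positivity
  have hpl : IsPicardLindelof (fun s x => G (P x) - B * u s) (tmin := 0) (tmax := τ)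
      ⟨0, le_rfl, hτ⟩ (u τ) ⟨M * τ, by positivity⟩ 0 ⟨M, hM0⟩ L := by
    refine ⟨fun t _ => ?_, fun x _ => ?_, fun t ht x _ => ?_, ?_⟩
    · refine LipschitzWith.lipschitzOnWith (LipschitzWith.of_dist_le_mul fun x y => ?_)
      simpa using hLP.dist_le_mul x y
    · exact continuousOn_const.sub (continuousOn_const.mul hu)
    · refine (norm_sub_le _ _).trans (add_le_add (hM₁ _ (hPmem x)) ?_)
      rw [norm_mul]
      exact mul_le_mul_of_nonneg_left (hm t ht) (norm_nonneg _)
    · change M * max (τ - 0) (0 - 0) ≤ M * τ - 0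
      simp [hτ]
  obtain ⟨v, hv0, hv⟩ := hpl.exists_eq_forall_mem_Icc_hasDerivWithinAt₀
  have hstep : IsDelayStep (fun x => G (P x)) B τ u v := ⟨hv0, hv⟩
  refine ⟨v, hv0, fun s hs => (hv s hs).congr_deriv ?_⟩
  rw [hPeq (v s) ((hstep.abs_le hC0 hGP hm hs).trans (by linarith))]

/-! ### Solutions and their segments -/

/-- A solution also satisfies the equation at time `0`, with the one-sided derivative. -/
theorem IsDDESolution.hasDerivWithinAt {f : ℝ → ℝ → ℝ} {τ : ℝ} {φ x : ℝ → ℝ}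
    (hx : IsDDESolution f τ φ x) (hf : Continuous fun p : ℝ × ℝ => f p.1 p.2) (hτ : 0 ≤ τ) {t : ℝ}
    (ht : 0 ≤ t) : HasDerivWithinAt x (f (x t) (x (t - τ))) (Ici 0) t := by
  rcases ht.eq_or_lt with rfl | ht
  · have hc : ContinuousWithinAt x (Ioi 0) 0 :=
      (hx.continuousOn 0 (by simpa using hτ)).mono fun s (hs : 0 < s) => by
        simp only [mem_Ici]; linarith
    have hcτ : ContinuousWithinAt (fun t => x (t - τ)) (Ioi 0) 0 := by
      refine ContinuousWithinAt.comp (t := Ici (-τ)) (hx.continuousOn (0 - τ) (by simp))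
        (by fun_prop) fun s (hs : 0 < s) => ?_
      simp only [mem_Ici]; linarith
    refine hasDerivWithinAt_Ici_of_tendsto_deriv
      (fun t ht => (hx.equation t ht).differentiableAt.differentiableWithinAt) hc
      self_mem_nhdsWithin ?_
    have h1 : Tendsto (fun t => f (x t) (x (t - τ))) (𝓝[>] 0) (𝓝 (f (x 0) (x (0 - τ)))) :=
      (hf.tendsto (x 0, x (0 - τ))).comp (hc.prodMk_nhds hcτ)
    refine h1.congr' ?_
    filter_upwards [self_mem_nhdsWithin] with t ht using (hx.equation t ht).deriv.symm
  · exact (hx.equation t ht).hasDerivWithinAt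

/-- The delay equation with equilibrium `e` whose deviation `y = x - e` solves
`y'(t) = G (y t) - B y(t - τ)`. -/
def deviationField (G : ℝ → ℝ) (B e : ℝ) (x y : ℝ) : ℝ :=
  G (x - e) - B * (y - e)

/-- The deviation of `x` from `e` on `[(n - 1) τ, n τ]`, read as a function on `[0, τ]`. -/
def segment (e τ : ℝ) (x : ℝ → ℝ) (n : ℕ) (s : ℝ) : ℝ :=
  x (n * τ - τ + s) - e

theorem IsDDESolution.continuousOn_segment {f : ℝ → ℝ → ℝ} {e τ : ℝ} {φ x : ℝ → ℝ}
    (hx : IsDDESolution f τ φ x) (n : ℕ) : ContinuousOn (segment e τ x n) (Icc 0 τ) := by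
  refine ContinuousOn.sub (hx.continuousOn.comp (by fun_prop) fun s hs => ?_) continuousOn_const
  have : 0 ≤ n * τ := mul_nonneg n.cast_nonneg (hs.1.trans hs.2)
  simp only [mem_Ici]
  linarith [hs.1]

theorem IsDDESolution.isDelayStep_segment {G : ℝ → ℝ} (hG : Continuous G) {B e τ : ℝ} (hτ : 0 ≤ τ)
    {φ x : ℝ → ℝ} (hx : IsDDESolution (deviationField G B e) τ φ x) (n : ℕ) :
    IsDelayStep G B τ (segment e τ x n) (segment e τ x (n + 1)) := by
  constructor
  · simp only [segment]
    congr 2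
    push_cast
    ring
  · intro s hs
    have hn : 0 ≤ n * τ := mul_nonneg n.cast_nonneg hτ
    have hshift : ∀ s, ((n + 1 : ℕ) : ℝ) * τ - τ + s = n * τ + s := fun s => by push_cast; ring
    have hd := hx.hasDerivWithinAt (by unfold deviationField; fun_prop) hτ
      (add_nonneg hn hs.1)
    have h1 : HasDerivWithinAt (fun s : ℝ => n * τ + s) 1 (Icc 0 τ) s :=
      ((hasDerivAt_id s).const_add _).hasDerivWithinAt
    have h2 := hd.comp s h1 fun s hs => add_nonneg hn hs.1
    have h3 := h2.sub_const e
    have hseg : segment e τ x (n + 1) = fun s => x (n * τ + s) - e := by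
      ext s; simp only [segment, hshift]
    rw [hseg]
    refine h3.congr_deriv ?_
    simp only [deviationField, segment, mul_one]
    congr 4
    ring

/-- The function on `[-τ, ∞)` whose segments are `z 0, z 1, …`. -/
noncomputable def glueSegments (e τ : ℝ) (z : ℕ → ℝ → ℝ) (t : ℝ) : ℝ :=
  e + z ⌊(t + τ) / τ⌋₊ (t + τ - ⌊(t + τ) / τ⌋₊ * τ)

theorem glueSegments_apply {e τ : ℝ} (hτ : 0 < τ) {z : ℕ → ℝ → ℝ}
    (hz : ∀ n, z (n + 1) 0 = z n τ) (n : ℕ) {s : ℝ} (hs : s ∈ Icc 0 τ) :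
    glueSegments e τ z (n * τ - τ + s) = e + z n s := by
  have h0 : n * τ - τ + s + τ = n * τ + s := by ring
  rw [glueSegments, h0]
  rcases hs.2.eq_or_lt with rfl | hlt
  · have h1 : ⌊(n * s + s) / s⌋₊ = n + 1 := by
      have : (n * s + s) / s = ((n + 1 : ℕ) : ℝ) := by field_simp; push_cast; ring
      rw [this, Nat.floor_natCast]
    rw [h1, ← hz n]
    congr 2
    push_cast
    ring
  · have h1 : ⌊(n * τ + s) / τ⌋₊ = n := by
      rw [Nat.floor_eq_iff (div_nonneg (add_nonneg (by positivity) hs.1) hτ.le),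
        le_div_iff₀ hτ, div_lt_iff₀ hτ]
      constructor <;> nlinarith [hs.1]
    rw [h1]
    congr 2
    ring

/-- Segments that continue each other form a solution. -/
theorem isDDESolution_glueSegments {G : ℝ → ℝ} {B e τ : ℝ} (hτ : 0 < τ) {z : ℕ → ℝ → ℝ}
    {φ : ℝ → ℝ} (hφ : ContinuousOn φ (Icc (-τ) 0)) (hz0 : ∀ s, z 0 s = φ (s - τ) - e)
    (hz : ∀ n, IsDelayStep G B τ (z n) (z (n + 1))) :
    IsDDESolution (deviationField G B e) τ φ (glueSegments e τ z) := by
  set x := glueSegments e τ z with hx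
  have hval : ∀ (n : ℕ) {s : ℝ}, s ∈ Icc 0 τ → x (n * τ - τ + s) = e + z n s := fun n s hs =>
    glueSegments_apply hτ (fun n => (hz n).start) n hs
  have hhist : ∀ s ∈ Icc (-τ) 0, x s = φ s := by
    intro s hs
    have := hval 0 (s := s + τ) ⟨by linarith [hs.1], by linarith [hs.2]⟩
    rw [hz0] at this
    have h1 : ((0 : ℕ) : ℝ) * τ - τ + (s + τ) = s := by push_cast; ring
    rw [h1] at this
    rw [this]
    ring_nf
  have hwithin : ∀ (n : ℕ), ∀ t ∈ Icc (n * τ) (n * τ + τ), HasDerivWithinAt x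
      (deviationField G B e (x t) (x (t - τ))) (Icc (n * τ) (n * τ + τ)) t := by
    intro n t ht
    have hmem : ∀ {t}, t ∈ Icc (n * τ) (n * τ + τ) → t - n * τ ∈ Icc 0 τ := fun ht =>
      ⟨by linarith [ht.1], by linarith [ht.2]⟩
    have hxt : ∀ t ∈ Icc (n * τ) (n * τ + τ), x t = e + z (n + 1) (t - n * τ) := by
      intro t ht
      rw [← hval (n + 1) (hmem ht)]
      congr 1
      push_cast
      ring
    have hxτ : x (t - τ) = e + z n (t - n * τ) := by
      rw [← hval n (hmem ht)]
      congr 1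
      ring
    have h1 : HasDerivWithinAt (fun t : ℝ => t - n * τ) 1 (Icc (n * τ) (n * τ + τ)) t :=
      ((hasDerivAt_id t).sub_const _).hasDerivWithinAt
    have h2 := (((hz n).deriv _ (hmem ht)).comp t h1 fun t ht => hmem ht).const_add e
    refine (h2.congr hxt (hxt t ht)).congr_deriv ?_
    rw [hxτ, hxt t ht]
    simp [deviationField]
  have heq : ∀ t : ℝ, 0 < t → HasDerivAt x (deviationField G B e (x t) (x (t - τ))) t := by
    intro t ht
    set n := ⌊t / τ⌋₊ with hn
    have h1 : n * τ ≤ t := by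
      rw [← le_div_iff₀ hτ]; exact Nat.floor_le (by positivity)
    have h2 : t < n * τ + τ := by
      have := Nat.lt_floor_add_one (t / τ)
      rw [div_lt_iff₀ hτ] at this
      linarith
    rcases h1.eq_or_lt with h1 | h1
    · -- at a node the two one-sided derivatives agree
      obtain ⟨k, hk⟩ : ∃ k, n = k + 1 := Nat.exists_eq_succ_of_ne_zero fun h0 => by
        simp [h0] at h1; linarith
      have hkt : k * τ + τ = t := by rw [← h1, hk]; push_cast; ring
      have h3 := (hwithin k t ⟨by linarith, hkt.ge⟩).union (hwithin n t ⟨h1.le, h2.le⟩)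
      refine h3.hasDerivAt (mem_of_superset
        (Icc_mem_nhds (a := k * τ) (b := n * τ + τ) (by linarith) h2) fun s hs => ?_)
      rcases le_total s t with hst | hst
      · exact Or.inl ⟨hs.1, by linarith⟩
      · exact Or.inr ⟨by linarith, hs.2⟩
    · exact (hwithin n t ⟨h1.le, h2.le⟩).hasDerivAt (Icc_mem_nhds h1 h2)
  refine ⟨fun t ht => ?_, hhist, heq⟩
  rcases lt_or_ge 0 t with h0 | h0
  · exact (heq t h0).continuousAt.continuousWithinAt
  · have h1 : ContinuousOn x (Icc (-τ) 0) := hφ.congr hhist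
    have h2 : ContinuousOn x (Icc 0 τ) := fun s hs => by
      have := (hwithin 0 s (by simpa using hs)).continuousWithinAt
      simpa using this
    have h3 := h1.union_of_isClosed h2 isClosed_Icc isClosed_Icc
    rw [Icc_union_Icc_eq_Icc (by linarith) hτ.le] at h3
    exact (h3 t ⟨ht, by linarith⟩).mono_of_mem_nhdsWithin
      (inter_mem_nhdsWithin (Ici (-τ)) (Iic_mem_nhds (by linarith : t < τ)))

/-- Global existence, by the method of steps. -/
theorem exists_isDDESolution {G : ℝ → ℝ} {B C e τ : ℝ} (hτ : 0 < τ) (hC0 : 0 ≤ C)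
    (hGd : ContDiff ℝ 1 G) (hG : ∀ x, x * G x ≤ C * x ^ 2) {φ : ℝ → ℝ}
    (hφ : ContinuousOn φ (Icc (-τ) 0)) : ∃ x, IsDDESolution (deviationField G B e) τ φ x := by
  choose next hnext using fun u : {u : ℝ → ℝ // ContinuousOn u (Icc 0 τ)} =>
    exists_isDelayStep (B := B) hτ.le hC0 hGd hG u.2
  let z₀ : {u : ℝ → ℝ // ContinuousOn u (Icc 0 τ)} := ⟨fun s => φ (s - τ) - e,
    (hφ.comp (by fun_prop) fun s hs => ⟨by linarith [hs.1], by linarith [hs.2]⟩).sub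
      continuousOn_const⟩
  let z : ℕ → {u : ℝ → ℝ // ContinuousOn u (Icc 0 τ)} := fun n =>
    Nat.rec z₀ (fun _ u => ⟨next u, (hnext u).continuousOn⟩) n
  exact ⟨_, isDDESolution_glueSegments hτ (z := fun n => (z n).1) hφ (fun _ => rfl)
    fun n => hnext (z n)⟩

/-! ### The principle of linearized stability -/

/-- If all characteristic roots of the linearization lie in the open left half plane, then the
equilibrium is locally asymptotically stable. -/
theorem locallyAsymptoticallyStable_deviationField {G : ℝ → ℝ} {A B C τ : ℝ} (e : ℝ) (hτ : 0 < τ)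
    (hC0 : 0 ≤ C) (hGd : ContDiff ℝ 1 G) (hG : ∀ x, x * G x ≤ C * x ^ 2) (hG0 : G 0 = 0)
    (hA : HasDerivAt G (-A) 0)
    (hroots : ∀ l : ℂ, l + A + B * Complex.exp (-l * τ) = 0 → l.re < 0) :
    LocallyAsymptoticallyStable (deviationField G B e) τ e := by
  obtain ⟨N, hN0, hN⟩ := exists_norm_delayOperator_pow_le hτ hroots
  obtain ⟨K, q, ε, hK, hq0, hq1, hε, hiter⟩ := exists_geometric_decay_of_approx_linear _ hN0 hN
  obtain ⟨ρ, hρ, hlin⟩ := exists_norm_sub_delayOperator_le (B := B) hτ.le hC0 hG hG0 hA hε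
  -- `t` lies in the segment with number `⌊t / τ⌋ + 1`
  have hdecay : ∀ δ : ℝ, 0 < δ → K * δ ≤ ρ → ∀ φ, IsHistoryNear τ e δ φ → ∀ x,
      IsDDESolution (deviationField G B e) τ φ x → ∀ t, 0 ≤ t →
      |x t - e| ≤ K * δ * q ^ (⌊t / τ⌋₊ + 1) := by
    intro δ hδ hδρ φ hφ x hx t ht
    set y : ℕ → C(Icc 0 τ, ℂ) := fun n => complexSegment _ (hx.continuousOn_segment (e := e) n)
      with hy
    have hy0 : ‖y 0‖ ≤ δ := norm_complexSegment_le _ hδ.le fun s hs => by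
      have hs' : ((0 : ℕ) : ℝ) * τ - τ + s ∈ Icc (-τ) 0 := by
        simp only [mem_Icc]
        push_cast
        constructor <;> linarith [hs.1, hs.2]
      simp only [segment]
      rw [hx.history _ hs']
      exact (hφ.2 _ hs').le
    have h1 := hiter ρ y (fun n hn => hlin _ _ (hx.continuousOn_segment n)
      (hx.isDelayStep_segment hGd.continuous hτ.le n) hn)
      ((mul_le_mul_of_nonneg_left hy0 hK.le).trans hδρ) (⌊t / τ⌋₊ + 1)
    set n := ⌊t / τ⌋₊ with hn
    have h2 : n * τ ≤ t := by
      rw [← le_div_iff₀ hτ]; exact Nat.floor_le (by positivity)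
    have h3 : t < n * τ + τ := by
      have := Nat.lt_floor_add_one (t / τ)
      rw [div_lt_iff₀ hτ] at this
      linarith
    have h4 := abs_le_norm_complexSegment (hx.continuousOn_segment (e := e) (n + 1))
      (s := t - n * τ) ⟨by linarith, by linarith⟩
    have h5 : segment e τ x (n + 1) (t - n * τ) = x t - e := by
      simp only [segment]
      congr 2
      push_cast
      ring
    rw [h5] at h4
    exact h4.trans (h1.trans (by gcongr))
  constructor
  · intro r hr
    have hδ : 0 < min ρ (r / 2) / K := by positivity
    have hKδ : K * (min ρ (r / 2) / K) = min ρ (r / 2) := by field_simp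
    refine ⟨min ρ (r / 2) / K, hδ, fun φ hφ => ⟨exists_isDDESolution hτ hC0 hGd hG hφ.1,
      fun x hx t ht => ?_⟩⟩
    have h1 := hdecay _ hδ (by rw [hKδ]; exact min_le_left _ _) φ hφ x hx t ht
    rw [hKδ] at h1
    have h2 : min ρ (r / 2) * q ^ (⌊t / τ⌋₊ + 1) ≤ min ρ (r / 2) :=
      mul_le_of_le_one_right (by positivity) (pow_le_one₀ hq0 hq1.le)
    linarith [min_le_right ρ (r / 2)]
  · have hKδ : K * (ρ / K) = ρ := by field_simp
    refine ⟨ρ / K, by positivity, fun φ hφ x hx => ?_⟩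
    have h1 := hdecay _ (by positivity) hKδ.le φ hφ x hx
    have hn : Tendsto (fun t : ℝ => ⌊t / τ⌋₊ + 1) atTop atTop :=
      (tendsto_add_atTop_nat 1).comp
        (tendsto_nat_floor_atTop.comp (tendsto_id.atTop_div_const hτ))
    have h2 : Tendsto (fun t : ℝ => K * (ρ / K) * q ^ (⌊t / τ⌋₊ + 1)) atTop (𝓝 0) := by
      simpa using ((tendsto_pow_atTop_nhds_zero_of_lt_one hq0 hq1).comp hn).const_mul
        (K * (ρ / K))
    have h3 : Tendsto (fun t => x t - e) atTop (𝓝 0) :=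
      squeeze_zero_norm' ((eventually_ge_atTop 0).mono h1) h2
    simpa using h3.add_const e

/-- Without delay the equation may be read as one with delay `1` that ignores the delayed value. -/
theorem LocallyAsymptoticallyStable.of_delay_one {f : ℝ → ℝ → ℝ} {e : ℝ}
    (h : LocallyAsymptoticallyStable (fun x _ => f x x) 1 e) :
    LocallyAsymptoticallyStable f 0 e := by
  have hnear : ∀ {δ : ℝ} {φ : ℝ → ℝ}, IsHistoryNear 0 e δ φ →
      IsHistoryNear 1 e δ fun _ => φ 0 := fun hφ =>
    ⟨continuousOn_const, fun _ _ => hφ.2 0 (by simp)⟩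
  have hext : ∀ {φ x : ℝ → ℝ}, IsDDESolution f 0 φ x →
      IsDDESolution (fun x _ => f x x) 1 (fun _ => φ 0) fun t => x (max t 0) := by
    intro φ x hx
    refine ⟨hx.continuousOn.comp (by fun_prop) fun t _ => by simp, fun s hs => ?_, fun t ht => ?_⟩
    · rw [max_eq_right hs.2]
      exact hx.history 0 (by simp)
    · have h1 := hx.equation t ht
      rw [sub_zero] at h1
      rw [max_eq_left ht.le]
      refine h1.congr_of_eventuallyEq ?_
      filter_upwards [lt_mem_nhds ht] with s hs
      rw [max_eq_left hs.le]
  obtain ⟨hs, δ₁, hδ₁, ha⟩ := h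
  refine ⟨fun ε hε => ?_, δ₁, hδ₁, fun φ hφ x hx => ?_⟩
  · obtain ⟨δ, hδ, hsδ⟩ := hs ε hε
    refine ⟨δ, hδ, fun φ hφ => ?_⟩
    obtain ⟨⟨x, hx⟩, hall⟩ := hsδ _ (hnear hφ)
    refine ⟨⟨x, hx.continuousOn.mono (Ici_subset_Ici.2 (by norm_num)), fun s hs => ?_,
      fun t ht => ?_⟩, fun x hx t ht => ?_⟩
    · have h0 : s = 0 := by simpa using hs
      rw [h0]
      exact hx.history 0 (by simp)
    · rw [sub_zero]
      exact hx.equation t ht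
    · simpa [max_eq_left ht] using hall _ (hext hx) t ht
  · refine (ha _ (hnear hφ) _ (hext hx)).congr' ?_
    filter_upwards [eventually_ge_atTop 0] with t ht
    rw [max_eq_left ht]

/-! ### Characteristic roots, loop gain and the exact stability bound -/

/-- A root in the closed right half plane would satisfy `|Im z| ≤ B`, hence `|Im z| τ < π / 2`, and
then the real part of the characteristic function is positive. -/
theorem re_neg_of_characteristic_root {A B τ : ℝ} (hA : 0 ≤ A) (hB : 0 < B) (hτ : 0 ≤ τ)
    (h : B * τ < Real.pi / 2) {z : ℂ} (hz : z + A + B * Complex.exp (-z * τ) = 0) : z.re < 0 := by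
  by_contra! hre
  have hexp : ‖Complex.exp (-z * τ)‖ ≤ 1 := by
    rw [Complex.norm_exp, Real.exp_le_one_iff]
    simpa using mul_nonneg hre hτ
  have him : |z.im| ≤ B := by
    have h1 : z + A = -(B * Complex.exp (-z * τ)) := by linear_combination hz
    calc |z.im| = |(z + A).im| := by simp
      _ ≤ ‖z + A‖ := Complex.abs_im_le_norm _
      _ = B * ‖Complex.exp (-z * τ)‖ := by
        rw [h1, norm_neg, norm_mul, Complex.norm_real, Real.norm_of_nonneg hB.le]
      _ ≤ B := mul_le_of_le_one_right hB.le hexp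
  have hcos : 0 < Real.cos (z.im * τ) := by
    have h1 : |z.im * τ| < Real.pi / 2 := by
      rw [abs_mul, abs_of_nonneg hτ]
      exact (mul_le_mul_of_nonneg_right him hτ).trans_lt h
    exact Real.cos_pos_of_mem_Ioo (abs_lt.1 h1)
  have h1 := congrArg Complex.re hz
  simp [Complex.exp_re] at h1
  have : 0 < B * (Real.exp (-(z.re * τ)) * Real.cos (z.im * τ)) := by positivity
  linarith

/-- At a phase crossing with loop gain at least `1` the frequency would be at most `B`, hence the
phase lag of the delay below `π / 2`, and the loop transfer function could not be negative. -/
theorem norm_loop_lt_one {A B τ ω : ℝ} (hA : 0 ≤ A) (hB : 0 < B) (hτ : 0 ≤ τ)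
    (h : B * τ < Real.pi / 2) (hω : 0 < ω)
    (harg : (B * Complex.exp (-(ω * Complex.I) * τ) / (ω * Complex.I + A)).arg = Real.pi) :
    ‖B * Complex.exp (-(ω * Complex.I) * τ) / (ω * Complex.I + A)‖ < 1 := by
  by_contra! hge
  set L : ℂ := B * Complex.exp (-(ω * Complex.I) * τ) / (ω * Complex.I + A) with hL
  have hden : (ω * Complex.I + A : ℂ) ≠ 0 := fun h0 => by
    have := congrArg Complex.im h0
    simp at this
    exact hω.ne' this
  have hmul : L * (ω * Complex.I + A) = B * Complex.exp (-(ω * Complex.I) * τ) := by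
    rw [hL, div_mul_cancel₀ _ hden]
  have hLneg : L = -(‖L‖ : ℂ) := by
    have h1 := Complex.norm_mul_exp_arg_mul_I L
    rw [harg, Complex.exp_pi_mul_I] at h1
    rw [← h1]
    simp
  have hexp : ‖Complex.exp (-(ω * Complex.I) * τ)‖ = 1 := by
    rw [Complex.norm_exp]; simp
  have hωB : ω ≤ B := by
    have h1 : ω ≤ ‖(ω * Complex.I + A : ℂ)‖ := by
      have := Complex.abs_im_le_norm (ω * Complex.I + A : ℂ)
      simpa [abs_of_pos hω] using this
    have h2 := congrArg norm hmul
    rw [norm_mul, norm_mul, hexp, Complex.norm_real, Real.norm_of_nonneg hB.le, mul_one] at h2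
    nlinarith [norm_nonneg (ω * Complex.I + A : ℂ)]
  have hcos : 0 < Real.cos (ω * τ) := by
    apply Real.cos_pos_of_mem_Ioo
    have : ω * τ ≤ B * τ := by gcongr
    constructor
    · have : 0 ≤ ω * τ := by positivity
      linarith [Real.pi_pos]
    · linarith
  rw [hLneg] at hmul
  have h1 := congrArg Complex.re hmul
  simp [Complex.exp_re] at h1
  have h2 : 0 ≤ ‖L‖ * A := by positivity
  have h3 : 0 < B * Real.cos (ω * τ) := by positivity
  linarith

/-- Both factors of `b * exactBound a b = arccos (-a / b) * (b / √(b ^ 2 - a ^ 2))` are least at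
`a = 0`. -/
theorem isLeast_mul_exactBound {b : ℝ} (hb : 0 < b) :
    IsLeast ((fun a : ℝ => b * exactBound a b) '' Ico 0 b) (Real.pi / 2) := by
  constructor
  · refine ⟨0, ⟨le_rfl, hb⟩, ?_⟩
    have h1 : Real.sqrt (b ^ 2 - 0 ^ 2) = b := by
      rw [zero_pow two_ne_zero, sub_zero, Real.sqrt_sq hb.le]
    simp only [exactBound, h1, neg_zero, zero_div, Real.arccos_zero]
    field_simp
  · rintro _ ⟨a, ⟨ha0, hab⟩, rfl⟩
    have hpos : 0 < b ^ 2 - a ^ 2 := by nlinarith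
    have hs : 0 < Real.sqrt (b ^ 2 - a ^ 2) := Real.sqrt_pos.2 hpos
    have hsb : Real.sqrt (b ^ 2 - a ^ 2) ≤ b := Real.sqrt_le_iff.2 ⟨hb.le, by nlinarith⟩
    have harc : Real.pi / 2 ≤ Real.arccos (-a / b) := by
      rw [← not_lt, Real.arccos_lt_pi_div_two, not_lt]
      exact div_nonpos_of_nonpos_of_nonneg (by linarith) hb.le
    have h1 : b * exactBound a b
        = Real.arccos (-a / b) * (b / Real.sqrt (b ^ 2 - a ^ 2)) := by
      rw [exactBound]; ring
    simp only [h1]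
    calc Real.pi / 2 ≤ Real.arccos (-a / b) := harc
      _ ≤ _ := le_mul_of_one_le_right (Real.arccos_nonneg _) ((one_le_div hs).2 hsb)

/-! ### The Boissonade–De Kepper model -/

theorem isEquilibrium_field_iff {η μ Λ b e : ℝ} (hη : 0 < η) :
    IsEquilibrium (field η μ Λ b) e ↔ e ^ 3 + (b - μ) * e + Λ = 0 := by
  have h : field η μ Λ b e e = -η * (e ^ 3 + (b - μ) * e + Λ) := by rw [field]; ring
  rw [IsEquilibrium, h, mul_eq_zero]
  simp [hη.ne']

theorem existsUnique_isEquilibrium {η μ Λ b : ℝ} (hη : 0 < η) (hμ : μ < b) :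
    ∃! e : ℝ, IsEquilibrium (field η μ Λ b) e := by
  simp only [isEquilibrium_field_iff hη]
  have hmono : StrictMono fun e : ℝ => e ^ 3 + (b - μ) * e + Λ := by
    intro x y hxy
    have h1 : x ^ 3 < y ^ 3 := (Odd.strictMono_pow (by decide)) hxy
    have h2 : (b - μ) * x < (b - μ) * y := mul_lt_mul_of_pos_left hxy (by linarith)
    simp only
    linarith
  have hd : 0 < b - μ := by linarith
  set r : ℝ := |Λ| / (b - μ) with hr
  have hr0 : 0 ≤ r := by positivity
  have hrΛ : (b - μ) * r = |Λ| := by rw [hr]; field_simp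
  have hmem : (0 : ℝ) ∈ Icc ((-r) ^ 3 + (b - μ) * -r + Λ) (r ^ 3 + (b - μ) * r + Λ) := by
    have := le_abs_self Λ
    have := neg_abs_le Λ
    have : 0 ≤ r ^ 3 := by positivity
    constructor <;> nlinarith
  obtain ⟨e, -, he⟩ := intermediate_value_Icc (f := fun e : ℝ => e ^ 3 + (b - μ) * e + Λ)
    (by linarith : -r ≤ r) (by fun_prop) hmem
  exact ⟨e, he, fun y hy => hmono.injective (hy.trans he.symm)⟩

/-- The instantaneous part of the model in terms of the deviation from an equilibrium `e`. -/
def cubicDeviation (η a e : ℝ) (x : ℝ) : ℝ :=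
  -η * (x ^ 3 + 3 * e * x ^ 2 + a * x)

theorem field_eq_deviationField {η μ Λ b e : ℝ} (he : IsEquilibrium (field η μ Λ b) e) :
    field η μ Λ b = deviationField (cubicDeviation η (3 * e ^ 2 - μ) e) (η * b) e := by
  ext x y
  have h : η * (-(e ^ 3 - μ * e + Λ) - b * e) = 0 := he
  simp only [field, deviationField, cubicDeviation]
  linear_combination h

theorem contDiff_cubicDeviation (η a e : ℝ) : ContDiff ℝ 1 (cubicDeviation η a e) := by
  unfold cubicDeviation; fun_prop

theorem hasDerivAt_cubicDeviation (η a e : ℝ) :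
    HasDerivAt (cubicDeviation η a e) (-(η * a)) 0 := by
  have h : HasDerivAt (fun x : ℝ => -η * (x ^ 3 + 3 * e * x ^ 2 + a * x))
      (-η * (3 * 0 ^ 2 + 3 * e * (2 * 0) + a)) 0 := by
    have h1 := hasDerivAt_pow 3 (0 : ℝ)
    have h2 := (hasDerivAt_pow 2 (0 : ℝ)).const_mul (3 * e)
    have h3 := (hasDerivAt_id (0 : ℝ)).const_mul a
    refine (((h1.add h2).add h3).const_mul (-η)).congr_deriv ?_
    norm_num
  exact h.congr_deriv (by ring)

/-- The cubic term makes the model dissipative: `x ^ 2 + 3 e x + a ≥ -9 e ^ 2 / 4` if `a ≥ 0`. -/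
theorem mul_cubicDeviation_le {η a : ℝ} (hη : 0 < η) (ha : 0 ≤ a) (e x : ℝ) :
    x * cubicDeviation η a e x ≤ η * (9 * e ^ 2 / 4) * x ^ 2 := by
  have h : η * (9 * e ^ 2 / 4) * x ^ 2 - x * cubicDeviation η a e x
      = η * x ^ 2 * ((x + 3 * e / 2) ^ 2 + a) := by
    rw [cubicDeviation]; ring
  have : 0 ≤ η * x ^ 2 * ((x + 3 * e / 2) ^ 2 + a) := by positivity
  linarith

/-- Linearized stability for the model; a vanishing delay is covered by moving the delayed term
into the instantaneous part. -/
theorem locallyAsymptoticallyStable_field {η μ Λ b τ e : ℝ} (hη : 0 < η) (hb : 0 < b)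
    (hτ : 0 ≤ τ) (h : η * b * τ < Real.pi / 2) (he : IsEquilibrium (field η μ Λ b) e)
    (ha : 0 ≤ 3 * e ^ 2 - μ) : LocallyAsymptoticallyStable (field η μ Λ b) τ e := by
  set a := 3 * e ^ 2 - μ with ha'
  rcases hτ.eq_or_lt with rfl | hτ
  · apply LocallyAsymptoticallyStable.of_delay_one
    have hfield : (fun x _ => field η μ Λ b x x)
        = deviationField (cubicDeviation η (a + b) e) 0 e := by
      rw [field_eq_deviationField he]
      ext x y
      simp only [deviationField, cubicDeviation]
      ring
    rw [hfield]
    refine locallyAsymptoticallyStable_deviationField (A := η * (a + b)) e one_pos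
      (by positivity) (contDiff_cubicDeviation _ _ _) (mul_cubicDeviation_le hη (by positivity) e)
      (by simp [cubicDeviation]) (hasDerivAt_cubicDeviation _ _ _) fun l hl => ?_
    have hre : l.re = -(η * (a + b)) := by
      have := congrArg Complex.re hl
      simp only [Complex.ofReal_zero, zero_mul, add_zero, Complex.add_re, Complex.ofReal_re,
        Complex.zero_re] at this
      linarith
    rw [hre]
    have : 0 < η * (a + b) := by positivity
    linarith
  · rw [field_eq_deviationField he]
    exact locallyAsymptoticallyStable_deviationField e hτ (by positivity)
      (contDiff_cubicDeviation _ _ _) (mul_cubicDeviation_le hη ha e) (by simp [cubicDeviation])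
      (hasDerivAt_cubicDeviation _ _ _) fun l hl =>
        re_neg_of_characteristic_root (by positivity) (by positivity) hτ.le h hl

end BDModel

theorem mainTheorem2 (b : ℝ) (hb : 0 < b) :
    (∀ η τ : ℝ, 0 < η → 0 ≤ τ → η * b * τ < Real.pi / 2 →
      ∀ μ Λ : ℝ, μ < b →
        (∃! e : ℝ, BDModel.IsEquilibrium (BDModel.field η μ Λ b) e) ∧
        ∀ e : ℝ, BDModel.IsEquilibrium (BDModel.field η μ Λ b) e →
          0 ≤ 3 * e ^ 2 - μ →
            BDModel.LocallyAsymptoticallyStable (BDModel.field η μ Λ b) τ e ∧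
            (∀ z : ℂ, BDModel.charFun η (3 * e ^ 2 - μ) b τ z = 0 → z.re < 0) ∧
            (∀ ω : ℝ, 0 < ω →
              (BDModel.loopTransfer η (3 * e ^ 2 - μ) b τ (ω * Complex.I)).arg = Real.pi →
              ‖BDModel.loopTransfer η (3 * e ^ 2 - μ) b τ (ω * Complex.I)‖ < 1)) ∧
    IsLeast ((fun a : ℝ => b * BDModel.exactBound a b) '' Set.Ico 0 b) (Real.pi / 2) := by
  refine ⟨fun η τ hη hτ h μ Λ hμ => ⟨BDModel.existsUnique_isEquilibrium hη hμ,
    fun e he ha => ⟨BDModel.locallyAsymptoticallyStable_field hη hb hτ h he ha,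
      fun z hz => ?_, fun ω hω harg => ?_⟩⟩, BDModel.isLeast_mul_exactBound hb⟩
  · refine BDModel.re_neg_of_characteristic_root (mul_nonneg hη.le ha) (mul_pos hη hb) hτ h ?_
    rw [BDModel.charFun] at hz
    push_cast at hz ⊢
    exact hz
  · have h1 : BDModel.loopTransfer η (3 * e ^ 2 - μ) b τ (ω * Complex.I)
        = ((η * b : ℝ) : ℂ) * Complex.exp (-(ω * Complex.I) * τ)
          / (ω * Complex.I + ((η * (3 * e ^ 2 - μ) : ℝ) : ℂ)) := by
      rw [BDModel.loopTransfer]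
      push_cast
      ring
    rw [h1] at harg ⊢
    exact BDModel.norm_loop_lt_one (mul_nonneg hη.le ha) (mul_pos hη hb) hτ h hω harg
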